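/- Let $\mathbb K$ be a field, let $d,\delta\ge 0$ be integers, put $n=d+\delta$, $S=\mathbb K[x_1,\dots,x_n]$ and $\xi_\delta=\sum_{j=1}^{\delta}\binom{2j-1}{j}$, and assume $n\ge 2\delta$. Order the $\delta$-subsets of $[n]=\{1,\dots,n\}$ reverse lexicographically: $\{i_1<\dots<i_\delta\}<\{j_1<\dots<j_\delta\}$ if for some $q$ one has $i_q<j_q$ and $i_p=j_p$ for all $p>q$. Call a collection of $\delta$-subsets compressed if it is an initial segment of this order. Let $C$ be the collection of the first $\xi_\delta+1$ of the $\delta$-subsets of $[n]$ in this order, let $\Delta=\Delta^{n,\delta}_{\xi_\delta+1}$ be the simplicial complex generated by $C$ (the empty set counts as a face), and let $I=I^{\xi_\delta+1}_{n,d}\subset S$ be the complement ideal of $\Delta$, i.e. the ideal generated by the monomials $\prod_{i\in[n]\setminus F}x_i$ with $F$ a facet of $\Delta$. A pure simplicial complex is uniformly collapsible if one can drop one vertex from each facet so that the resulting faces are pairwise distinct. Write $\mu_d(I)$ for the number of minimal monomial generators of $I$ of degree $d$. A Stanley decomposition of $I$ is a finite direct sum decomposition $I=\bigoplus_i u_i\mathbb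 K[Z_i]$ of $\mathbb K$-vector spaces with $0\ne u_i\in I$ homogeneous in the $\mathbb Z^n$-grading and $Z_i\subset\{x_1,\dots,x_n\}$, and $\operatorname{sdepth}(I)$ is the maximum of $\min_i|Z_i|$ over all such decompositions. Then: 1. $C$ is compressed, $|C|=\xi_\delta+1$, and $C$ is the set of facets of $\Delta$. 2. $\Delta$ is pure of dimension $\delta-1$ with $f_{\delta-1}(\Delta)=\xi_\delta+1$ facets and only $f_{\delta-2}(\Delta)=\xi_\delta$ ridges (faces of dimension $\delta-2$), and $\Delta$ is not uniformly collapsible. 3. $I$ is generated by squarefree monomials of degree $\ge d$; the complex generated by the complements $[n]\setminus\operatorname{supp}(m)$ of the minimal monomial generators $m$ of $I$ is $\Delta$; $\mu_d(I)=\xi_\delta+1$; and $\operatorname{sdepth}(I)=d$. 4. $\min\left(\binom{n}{d+1},\xi_\delta\right)=\xi_\delta$, so $\mu_d(I)=\min\left(\binom{n}{d+1},\sum_{j=1}^{n-d}\binom{2j-1}{j}\right)+1$ while $\operatorname{sdepth}(I)=d$. Thus, for $1\le d<n$, the bound in the hypothesis of the following theorem is sharp (it cannot be increased by one): if a nonzero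 ideal $J\subset S$ generated by squarefree monomials of degree $\ge d$ satisfies $\mu_d(J)\le\min\left(\binom{n}{d+1},\sum_{j=1}^{n-d}\binom{2j-1}{j}\right)$, then $\operatorname{sdepth}(J)\ge d+1$. (This theorem itself is not part of the present claim.) -/

import Mathlib

namespace StanleyDepth

open MvPolynomial

/-! ### Simplicial complexes on the vertex set `Fin n` -/

/-- A simplicial complex over `[n]`. The empty face is allowed (it has dimension `-1`), and a
singleton need not be a face. -/
structure Complex (n : ℕ) where
  faces : Set (Finset (Fin n))
  down_closed : ∀ {F G : Finset (Fin n)}, F ∈ faces → G ⊆ F → G ∈ faces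

namespace Complex

variable {n : ℕ}

/-- The complex `⟨C⟩` generated by a collection `C` of subsets. -/
def generate (C : Set (Finset (Fin n))) : Complex n where
  faces := {F | ∃ T ∈ C, F ⊆ T}
  down_closed := fun ⟨T, hT, hF⟩ hG => ⟨T, hT, hG.trans hF⟩

/-- The facets: faces that are maximal with respect to inclusion. -/
def facets (Δ : Complex n) : Set (Finset (Fin n)) :=
  {F | Maximal (fun G => G ∈ Δ.faces) F}

/-- `f_i(Δ)`: the number of faces of dimension `i`, that is, of cardinality `i + 1`. -/
noncomputable def fNumber (Δ : Complex n) (i : ℤ) : ℕ :=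
  {F ∈ Δ.faces | (F.card : ℤ) = i + 1}.ncard

/-- All facets have dimension `i`. -/
def IsPure (Δ : Complex n) (i : ℤ) : Prop :=
  ∀ F ∈ Δ.facets, (F.card : ℤ) = i + 1

/-- From every facet one can drop one vertex in such a way that the resulting faces are pairwise
distinct. -/
def UniformlyCollapsible (Δ : Complex n) : Prop :=
  ∃ g : Finset (Fin n) → Finset (Fin n),
    (∀ F ∈ Δ.facets, ∃ v ∈ F, g F = F.erase v) ∧ Set.InjOn g Δ.facets

end Complex

/-! ### Compressed collections -/

/-- The strict reverse lexicographic order on `k`-subsets: if `S = {i_1 < ⋯ < i_k}` and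
`T = {j_1 < ⋯ < j_k}`, then for some `q` one has `i_q < j_q`, and `i_p = j_p` for all `p > q`. -/
def RevLexLT {n : ℕ} (k : ℕ) (S T : Finset (Fin n)) : Prop :=
  ∃ (hS : S.card = k) (hT : T.card = k) (q : Fin k),
    S.orderEmbOfFin hS q < T.orderEmbOfFin hT q ∧
      ∀ p : Fin k, q < p → S.orderEmbOfFin hS p = T.orderEmbOfFin hT p

/-- A collection of `k`-subsets of `[n]` is compressed if it is an initial segment of the reverse
lexicographic order. -/
def IsCompressed {n : ℕ} (k : ℕ) (C : Finset (Finset (Fin n))) : Prop :=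
  (∀ S ∈ C, S.card = k) ∧ ∀ S T : Finset (Fin n), RevLexLT k S T → T ∈ C → S ∈ C

open Classical in
/-- `C_{n,k}^l`: the first `l` of the `k`-subsets of `[n]` in the reverse lexicographic order,
that is, those with fewer than `l` predecessors. -/
noncomputable def compressed (n k l : ℕ) : Finset (Finset (Fin n)) :=
  {S ∈ Finset.powersetCard k (Finset.univ : Finset (Fin n)) |
    {T ∈ Finset.powersetCard k (Finset.univ : Finset (Fin n)) | RevLexLT k T S}.card < l}

/-- The complex `Δ_l^{n,k}` generated by `C_{n,k}^l`. -/
noncomputable def compressedComplex (n k l : ℕ) : Complex n :=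
  Complex.generate (compressed n k l : Set (Finset (Fin n)))

/-- `ξ_δ = ∑_{j=1}^{δ} binom(2j-1, j)`. -/
def xi (δ : ℕ) : ℕ := ∑ j ∈ Finset.Icc 1 δ, (2 * j - 1).choose j

/-! ### Monomial ideals -/

/-- The squarefree monomial `∏_{i ∈ A} x_i`. -/
noncomputable def sqfreeMonomial (K : Type*) [Field K] {n : ℕ} (A : Finset (Fin n)) :
    MvPolynomial (Fin n) K :=
  ∏ i ∈ A, X i

section Ideals

variable {K : Type*} [Field K] {n : ℕ}

/-- `I` is generated by squarefree monomials of degree at least `d`. -/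
def GeneratedBySqfreeOfDegreeGE (I : Ideal (MvPolynomial (Fin n) K)) (d : ℕ) : Prop :=
  ∃ 𝒜 : Set (Finset (Fin n)), (∀ A ∈ 𝒜, d ≤ A.card) ∧ I = Ideal.span (sqfreeMonomial K '' 𝒜)

/-- Exponents of the minimal generating monomials `G(I)`: the monomials in `I` that are minimal
with respect to divisibility. -/
def minGens (I : Ideal (MvPolynomial (Fin n) K)) : Set (Fin n →₀ ℕ) :=
  {a | Minimal (fun b => monomial b (1 : K) ∈ I) a}

/-- `μ_d(I)`: the number of minimal generating monomials of degree `d`. -/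
noncomputable def mu (d : ℕ) (I : Ideal (MvPolynomial (Fin n) K)) : ℕ :=
  {a ∈ minGens I | a.degree = d}.ncard

/-- The complement complex of `I`, generated by the complements of the supports of the minimal
generating monomials. -/
def complementComplex (I : Ideal (MvPolynomial (Fin n) K)) : Complex n :=
  Complex.generate {F | ∃ a ∈ minGens I, F = a.supportᶜ}

end Ideals

/-- The complement ideal of `Δ`, generated by the squarefree monomials supported on the complements
of the facets of `Δ`. -/
noncomputable def complementIdeal (K : Type*) [Field K] {n : ℕ} (Δ : Complex n) :
    Ideal (MvPolynomial (Fin n) K) :=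
  Ideal.span {m | ∃ F ∈ Δ.facets, m = sqfreeMonomial K Fᶜ}

/-- The ideal `I_{n,d}^l`, the complement ideal of `Δ_l^{n,n-d}` (used for `d ≤ n`). -/
noncomputable def compressedIdeal (K : Type*) [Field K] (n d l : ℕ) :
    Ideal (MvPolynomial (Fin n) K) :=
  complementIdeal K (compressedComplex n (n - d) l)

/-! ### Stanley depth -/

section Depth

variable {K : Type*} [Field K] {n : ℕ}

/-- The `K`-subspace `u K[Z]` of the polynomial ring. -/
noncomputable def stanleySpace (u : MvPolynomial (Fin n) K) (Z : Finset (Fin n)) :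
    Submodule K (MvPolynomial (Fin n) K) :=
  (Subalgebra.toSubmodule (Algebra.adjoin K (X '' (Z : Set (Fin n))))).map (LinearMap.mulLeft K u)

/-- A Stanley decomposition `I = ⨁_{i=1}^m u_i K[Z_i]`, each `u_i ∈ I` being homogeneous in the
`ℤⁿ`-grading (a scalar multiple of a monomial) and nonzero, so that `u_i K[Z_i]` is a free
`K[Z_i]`-module. -/
structure StanleyDecomposition (I : Ideal (MvPolynomial (Fin n) K)) where
  m : ℕ
  u : Fin m → MvPolynomial (Fin n) K
  Z : Fin m → Finset (Fin n)
  mem : ∀ i, u i ∈ I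
  homogeneous : ∀ i, ∃ (a : Fin n →₀ ℕ) (c : K), u i = monomial a c
  ne_zero : ∀ i, u i ≠ 0
  independent : iSupIndep fun i => stanleySpace (u i) (Z i)
  iSup_eq : ⨆ i, stanleySpace (u i) (Z i) = I.restrictScalars K

/-- The Stanley depth of a decomposition: the minimum of the `|Z_i|`. (There is at least one
summand as soon as `I ≠ 0`.) -/
noncomputable def StanleyDecomposition.depth {I : Ideal (MvPolynomial (Fin n) K)}
    (P : StanleyDecomposition I) : ℕ :=
  ⨅ i, (P.Z i).card

/-- `sdepth(I) = k`, for `I ≠ 0`: `k` is the maximum of the Stanley depths of the Stanley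
decompositions of `I`. -/
def IsStanleyDepth (I : Ideal (MvPolynomial (Fin n) K)) (k : ℕ) : Prop :=
  IsGreatest (Set.range fun P : StanleyDecomposition I => P.depth) k

end Depth

end StanleyDepth

/-!
The first `ξ_δ + 1` of the `δ`-subsets of `[n]` are, for `δ ≥ 1`, all `δ`-subsets of the first
`2δ - 1` vertices together with the sets obtained by adjoining the vertex `2δ` to the first
`ξ_{δ-1} + 1` of the `(δ - 1)`-subsets. The ridges decompose in the same way, and as
`binom(2δ - 1, δ - 1) = binom(2δ - 1, δ)`, the difference between the number of facets and the
number of ridges is the same for `δ` and `δ - 1`. It is one for `δ = 0`, where the empty set is the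
only facet (`exists_isInitSeg_card_shadow`). There are thus too few ridges for an injective choice
of one ridge in every facet, and the complex is not uniformly collapsible. The reverse
lexicographic order on `δ`-subsets is the colexicographic order (`revLexLT_iff`), and initial
segments of equal size coincide, which identifies the recursive description with `compressed`.

On the algebraic side all subspaces in sight are spanned by monomials, and a Stanley decomposition
is a partition of the exponents of `I` into cones `a + ℕ^Z`. Sorting the monomials of `I` by their
supports `A` gives the decomposition into the spaces `x_A K[A]`, of depth at least `d`
(`exists_stanleyDecomposition_le_depth`). Conversely, in any decomposition a generator `x_A` of
degree `d` must be the apex of its cone; if all the cones had dimension greater than `d`, each of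
them would contain some `x_A x_v` with `v ∉ A`, and these would be pairwise distinct
(`exists_injOn_insert_of_stanleyDecomposition`). Taking complements, this drops a vertex from each
facet with distinct results, which is impossible.
-/

namespace StanleyDepth

open MvPolynomial
open scoped FinsetFamily

/-! ### Reverse lexicographic and colexicographic order -/

lemma RevLexLT.toColex_lt {n k : ℕ} {S T : Finset (Fin n)} (h : RevLexLT k S T) :
    toColex S < toColex T := by
  obtain ⟨hS, hT, q, hq, hp⟩ := h
  -- The elements of `S` in positions above `q` lie in `T`, the others are below the `q`-th of `T`.
  have key : ∀ a ∈ S, a ∉ T → a < T.orderEmbOfFin hT q := by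
    intro a ha haT
    obtain ⟨p, rfl⟩ : a ∈ Set.range (S.orderEmbOfFin hS) := by simpa using ha
    rcases lt_or_ge q p with h | h
    · exact absurd (hp p h ▸ T.orderEmbOfFin_mem hT p) haT
    · exact ((S.orderEmbOfFin hS).monotone h).trans_lt hq
  have hqS : T.orderEmbOfFin hT q ∉ S := by
    intro hmem
    obtain ⟨p, hpq⟩ : T.orderEmbOfFin hT q ∈ Set.range (S.orderEmbOfFin hS) := by
      simpa using hmem
    rcases lt_or_ge q p with h | h
    · rw [hp p h] at hpq
      exact h.ne' ((T.orderEmbOfFin hT).injective hpq)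
    · exact absurd hpq (((S.orderEmbOfFin hS).monotone h).trans_lt hq).ne
  rw [Finset.Colex.toColex_lt_toColex]
  refine ⟨?_, fun a ha haT => ⟨_, T.orderEmbOfFin_mem hT q, hqS, (key a ha haT).le⟩⟩
  rintro rfl
  exact hqS (S.orderEmbOfFin_mem hT q)

lemma RevLexLT.total {n k : ℕ} {S T : Finset (Fin n)} (hS : S.card = k) (hT : T.card = k)
    (hne : S ≠ T) : RevLexLT k S T ∨ RevLexLT k T S := by
  classical
  let D : Finset (Fin k) := {p | S.orderEmbOfFin hS p ≠ T.orderEmbOfFin hT p}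
  have hD : D.Nonempty := by
    by_contra h
    rw [Finset.not_nonempty_iff_eq_empty, Finset.filter_eq_empty_iff] at h
    refine hne (Finset.coe_injective ?_)
    rw [← S.range_orderEmbOfFin hS, ← T.range_orderEmbOfFin hT]
    exact congrArg Set.range (funext fun p => not_not.1 (h (Finset.mem_univ p)))
  have hmax : ∀ p, D.max' hD < p → S.orderEmbOfFin hS p = T.orderEmbOfFin hT p := by
    intro p hp
    by_contra hc
    exact absurd (D.le_max' p (by simpa [D] using hc)) (not_le.2 hp)
  have hq : S.orderEmbOfFin hS (D.max' hD) ≠ T.orderEmbOfFin hT (D.max' hD) := by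
    simpa [D] using D.max'_mem hD
  rcases lt_or_gt_of_ne hq with h | h
  · exact Or.inl ⟨hS, hT, _, h, hmax⟩
  · exact Or.inr ⟨hT, hS, _, h, fun p hp => (hmax p hp).symm⟩

lemma revLexLT_iff {n k : ℕ} {S T : Finset (Fin n)} :
    RevLexLT k S T ↔ S.card = k ∧ T.card = k ∧ toColex S < toColex T := by
  refine ⟨fun h => ⟨h.1, h.2.1, h.toColex_lt⟩, fun ⟨hS, hT, h⟩ => ?_⟩
  have hne : S ≠ T := by rintro rfl; exact lt_irrefl _ h
  exact (RevLexLT.total hS hT hne).resolve_right fun h' => lt_asymm h h'.toColex_lt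

lemma isCompressed_of_isInitSeg {n k : ℕ} {B : Finset (Finset (Fin n))}
    (hB : Finset.Colex.IsInitSeg B k) : IsCompressed k B :=
  ⟨fun _ hS => hB.1 hS, fun _ _ h hT =>
    hB.2 hT ⟨(revLexLT_iff.1 h).2.2, (revLexLT_iff.1 h).1⟩⟩

/-- An initial segment is determined by its size, so it is the collection of those sets that have
fewer predecessors than it has members. -/
lemma compressed_card_eq_of_isInitSeg {n k : ℕ} {B : Finset (Finset (Fin n))}
    (hB : Finset.Colex.IsInitSeg B k) : compressed n k B.card = B := by
  classical
  ext S
  simp only [compressed, Finset.mem_filter, Finset.mem_powersetCard, Finset.subset_univ, true_and]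
  constructor
  · rintro ⟨hS, hlt⟩
    by_contra hSB
    refine absurd hlt (not_lt.2 (Finset.card_le_card fun T hT => ?_))
    have hTk : T.card = k := hB.1 hT
    refine Finset.mem_filter.2 ⟨Finset.mem_powersetCard.2 ⟨Finset.subset_univ _, hTk⟩, ?_⟩
    have hne : T ≠ S := by rintro rfl; exact hSB hT
    exact (RevLexLT.total hTk hS hne).resolve_right fun h =>
      hSB ((isCompressed_of_isInitSeg hB).2 _ _ h hT)
  · intro hS
    refine ⟨hB.1 hS, Finset.card_lt_card ?_⟩
    refine Finset.ssubset_iff_subset_ne.2 ⟨fun T hT => ?_, fun h => ?_⟩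
    · exact (isCompressed_of_isInitSeg hB).2 _ _ (Finset.mem_filter.1 hT).2 hS
    · rw [← h] at hS
      exact lt_irrefl _ (Finset.mem_filter.1 hS).2.toColex_lt

/-! ### The extremal initial segment -/

lemma xi_succ (δ : ℕ) : xi (δ + 1) = xi δ + (2 * δ + 1).choose (δ + 1) := by
  unfold xi
  rw [Finset.sum_Icc_succ_top (by omega)]
  rfl

/-- The initial segment with `ξ_δ + 1` members has only `ξ_δ` sets in its shadow. Passing from `δ`
to `δ + 1`, one takes all `(δ + 1)`-subsets of the first `2δ + 1` vertices and adjoins the next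
vertex to all members of the previous segment; the shadow arises from the `δ`-subsets of the first
`2δ + 1` vertices and the previous shadow in the same manner, and
`binom(2δ + 1, δ) = binom(2δ + 1, δ + 1)`. -/
theorem exists_isInitSeg_card_shadow (n δ : ℕ) (hn : 2 * δ ≤ n) :
    ∃ B : Finset (Finset (Fin n)), Finset.Colex.IsInitSeg B δ ∧ B.card = xi δ + 1 ∧
      (∂ B).card = xi δ ∧ ∀ S ∈ B, ∀ x ∈ S, x.val < 2 * δ := by
  induction δ with
  | zero =>
    refine ⟨{∅}, ⟨by simp [Set.Sized], ?_⟩, by simp [xi], by simp [xi], by simp⟩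
    intro s t _ ht
    simpa using ht.2
  | succ δ ih =>
    obtain ⟨B, hB, hcard, hshadow, hlt⟩ := ih (by omega)
    let e : Fin n := ⟨2 * δ + 1, by omega⟩
    let W : Finset (Fin n) := Finset.Iio e
    have hW : W.card = 2 * δ + 1 := by simp [W, e]
    have hBW : ∀ S ∈ B, S ⊆ W := fun S hS x hx => by
      have := hlt S hS x hx
      simp only [W, Finset.mem_Iio, Fin.lt_def, e]
      omega
    have heW : e ∉ W := by simp [W]
    have hsW : ∀ S ∈ ∂ B, S ⊆ W := fun S hS => by
      obtain ⟨T, hT, hST⟩ := Finset.exists_subset_of_mem_shadow hS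
      exact hST.trans (hBW T hT)
    -- Adjoining `e` is injective on families of subsets of `W`, and the new sets are not in `W`.
    have hunion : ∀ (𝒜 : Finset (Finset (Fin n))) (r : ℕ), (∀ S ∈ 𝒜, S ⊆ W) →
        (Finset.powersetCard r W ∪ 𝒜.image (insert e)).card = (2 * δ + 1).choose r + 𝒜.card := by
      intro 𝒜 r h
      rw [Finset.card_union_of_disjoint, Finset.card_powersetCard, hW, Finset.card_image_of_injOn]
      · intro S hS T hT hST
        rw [← Finset.erase_insert fun hm => heW (h S hS hm),
          ← Finset.erase_insert fun hm => heW (h T hT hm)]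
        exact congrArg (Finset.erase · e) hST
      · rw [Finset.disjoint_left]
        intro S hS hS'
        obtain ⟨T, -, rfl⟩ := Finset.mem_image.1 hS'
        exact heW ((Finset.mem_powersetCard.1 hS).1 (Finset.mem_insert_self _ _))
    refine ⟨Finset.powersetCard (δ + 1) W ∪ B.image (insert e), ⟨?_, ?_⟩, ?_, ?_, ?_⟩
    · intro S hS
      rcases Finset.mem_union.1 (Finset.mem_coe.1 hS) with h | h
      · exact (Finset.mem_powersetCard.1 h).2
      · obtain ⟨T, hT, rfl⟩ := Finset.mem_image.1 h
        rw [Finset.card_insert_of_notMem fun hm => heW (hBW T hT hm), hB.1 hT]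
    · rintro s t hs ⟨hts, htc⟩
      rcases Finset.mem_union.1 hs with h | h
      · refine Finset.mem_union_left _ (Finset.mem_powersetCard.2 ⟨fun x hx => ?_, htc⟩)
        exact Finset.mem_Iio.2 (Finset.Colex.forall_lt_mono hts.le
          (fun b hb => Finset.mem_Iio.1 ((Finset.mem_powersetCard.1 h).1 hb)) x hx)
      · obtain ⟨s', hs', rfl⟩ := Finset.mem_image.1 h
        have hle : ∀ x ∈ t, x ≤ e := Finset.Colex.forall_le_mono hts.le fun b hb => by
          rcases Finset.mem_insert.1 hb with rfl | hb
          · exact le_rfl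
          · exact (Finset.mem_Iio.1 (hBW s' hs' hb)).le
        by_cases het : e ∈ t
        · refine Finset.mem_union_right _ (Finset.mem_image.2 ⟨t.erase e, ?_,
            Finset.insert_erase het⟩)
          refine hB.2 hs' ⟨?_, by rw [Finset.card_erase_of_mem het, htc]; rfl⟩
          have h1 := (Finset.Colex.toColex_sdiff_lt_toColex_sdiff (u := {e})
            (Finset.singleton_subset_iff.2 het)
            (Finset.singleton_subset_iff.2 (Finset.mem_insert_self e s'))).2 hts
          rwa [Finset.sdiff_singleton_eq_erase, Finset.sdiff_singleton_eq_erase,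
            Finset.erase_insert fun hm => heW (hBW s' hs' hm)] at h1
        · refine Finset.mem_union_left _ (Finset.mem_powersetCard.2 ⟨fun x hx => ?_, htc⟩)
          exact Finset.mem_Iio.2 (lt_of_le_of_ne (hle x hx) (by rintro rfl; exact het hx))
    · rw [hunion B _ hBW, hcard, xi_succ]
      omega
    · have : ∂ (Finset.powersetCard (δ + 1) W ∪ B.image (insert e)) =
          Finset.powersetCard δ W ∪ (∂ B).image (insert e) := by
        ext t
        constructor
        · intro ht
          obtain ⟨s, hs, a, ha, rfl⟩ := Finset.mem_shadow_iff.1 ht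
          rcases Finset.mem_union.1 hs with h | h
          · rw [Finset.mem_powersetCard] at h
            refine Finset.mem_union_left _ (Finset.mem_powersetCard.2
              ⟨(Finset.erase_subset _ _).trans h.1, ?_⟩)
            rw [Finset.card_erase_of_mem ha, h.2]
            rfl
          · obtain ⟨s', hs', rfl⟩ := Finset.mem_image.1 h
            have hes : e ∉ s' := fun hm => heW (hBW s' hs' hm)
            by_cases hae : a = e
            · subst hae
              rw [Finset.erase_insert hes]
              exact Finset.mem_union_left _ (Finset.mem_powersetCard.2 ⟨hBW s' hs', hB.1 hs'⟩)
            · rw [Finset.erase_insert_of_ne (Ne.symm hae)]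
              exact Finset.mem_union_right _ (Finset.mem_image_of_mem _
                (Finset.erase_mem_shadow hs' ((Finset.mem_insert.1 ha).resolve_left hae)))
        · intro ht
          rcases Finset.mem_union.1 ht with h | h
          · rw [Finset.mem_powersetCard] at h
            obtain ⟨a, haW, hat⟩ := Finset.exists_mem_notMem_of_card_lt_card
              (show t.card < W.card by omega)
            refine Finset.mem_shadow_iff_insert_mem.2 ⟨a, hat, Finset.mem_union_left _
              (Finset.mem_powersetCard.2 ⟨Finset.insert_subset haW h.1, ?_⟩)⟩
            rw [Finset.card_insert_of_notMem hat, h.2]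
          · obtain ⟨t', ht', rfl⟩ := Finset.mem_image.1 h
            obtain ⟨a, hat, ha⟩ := Finset.mem_shadow_iff_insert_mem.1 ht'
            have hae : a ≠ e := by
              rintro rfl
              exact heW (hBW _ ha (Finset.mem_insert_self _ _))
            refine Finset.mem_shadow_iff_insert_mem.2 ⟨a, by simp [hae, hat],
              Finset.mem_union_right _ (Finset.mem_image.2 ⟨_, ha, Finset.insert_comm _ _ _⟩)⟩
      rw [this, hunion _ _ hsW, hshadow, xi_succ, Nat.choose_symm_half]
      omega
    · intro S hS x hx
      rcases Finset.mem_union.1 hS with h | h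
      · have := Finset.mem_Iio.1 ((Finset.mem_powersetCard.1 h).1 hx)
        simp only [Fin.lt_def, e] at this
        omega
      · obtain ⟨s', hs', rfl⟩ := Finset.mem_image.1 h
        rcases Finset.mem_insert.1 hx with rfl | hx
        · simp only [e]
          omega
        · have := hlt s' hs' x hx
          omega

/-! ### Complexes generated by sets of equal size -/

namespace Complex

variable {n k : ℕ} {B : Finset (Finset (Fin n))}

lemma facets_generate (hB : (B : Set (Finset (Fin n))).Sized k) :
    (generate (B : Set (Finset (Fin n)))).facets = B := by
  ext F
  constructor
  · rintro ⟨⟨T, hT, hFT⟩, hmax⟩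
    rwa [hFT.antisymm (hmax ⟨T, hT, subset_rfl⟩ hFT)]
  · intro hF
    refine ⟨⟨F, hF, subset_rfl⟩, ?_⟩
    rintro G ⟨T, hT, hGT⟩ hFG
    have hFT : F = T := Finset.eq_of_subset_of_card_le (hFG.trans hGT) (by rw [hB hF, hB hT])
    exact hFT ▸ hGT

lemma fNumber_generate_top (hB : (B : Set (Finset (Fin n))).Sized k) :
    (generate (B : Set (Finset (Fin n)))).fNumber ((k : ℤ) - 1) = B.card := by
  rw [fNumber, ← Set.ncard_coe_finset]
  congr 1
  ext F
  constructor
  · rintro ⟨⟨T, hT, hFT⟩, hc⟩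
    rwa [Finset.eq_of_subset_of_card_le hFT (by rw [hB hT]; omega)]
  · intro hF
    exact ⟨⟨F, hF, subset_rfl⟩, by rw [hB hF]; ring⟩

lemma fNumber_generate_ridges (hB : (B : Set (Finset (Fin n))).Sized k) :
    (generate (B : Set (Finset (Fin n)))).fNumber ((k : ℤ) - 2) = (∂ B).card := by
  rw [fNumber, ← Set.ncard_coe_finset]
  congr 1
  ext F
  rw [Finset.mem_coe, Finset.mem_shadow_iff_exists_mem_card_add_one]
  constructor
  · rintro ⟨⟨T, hT, hFT⟩, hc⟩
    exact ⟨T, hT, hFT, by rw [hB hT]; omega⟩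
  · rintro ⟨T, hT, hFT, hc⟩
    refine ⟨⟨T, hT, hFT⟩, ?_⟩
    rw [hB hT] at hc
    omega

lemma not_uniformlyCollapsible_generate (hB : (B : Set (Finset (Fin n))).Sized k)
    (hlt : (∂ B).card < B.card) :
    ¬ (generate (B : Set (Finset (Fin n)))).UniformlyCollapsible := by
  rintro ⟨g, hg, hinj⟩
  rw [facets_generate hB] at hg hinj
  refine absurd (Finset.card_le_card_of_injOn g (fun F hF => ?_) hinj) (not_le.2 hlt)
  obtain ⟨v, hv, h⟩ := hg F hF
  rw [h]
  exact Finset.erase_mem_shadow hF hv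

end Complex

/-! ### Squarefree monomial ideals -/

section Monomial

variable {K : Type*} [Field K] {n : ℕ}

/-- The exponent vector of the squarefree monomial with support `A`. -/
noncomputable def sqfreeExponent (A : Finset (Fin n)) : Fin n →₀ ℕ :=
  ∑ i ∈ A, Finsupp.single i 1

lemma sqfreeExponent_apply (A : Finset (Fin n)) (i : Fin n) :
    sqfreeExponent A i = if i ∈ A then 1 else 0 := by
  simp [sqfreeExponent, Finsupp.finsetSum_apply, Finsupp.single_apply]

lemma sqfreeMonomial_eq (A : Finset (Fin n)) :
    sqfreeMonomial K A = monomial (sqfreeExponent A) 1 := by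
  rw [sqfreeExponent, monomial_sum_one]
  rfl

@[simp] lemma support_sqfreeExponent (A : Finset (Fin n)) : (sqfreeExponent A).support = A := by
  ext i
  simp [sqfreeExponent_apply]

lemma degree_sqfreeExponent (A : Finset (Fin n)) : (sqfreeExponent A).degree = A.card := by
  simp [sqfreeExponent]

lemma sqfreeExponent_injective :
    Function.Injective (sqfreeExponent : Finset (Fin n) → Fin n →₀ ℕ) := fun A B h => by
  rw [← support_sqfreeExponent A, h, support_sqfreeExponent]

lemma sqfreeExponent_le_iff {A : Finset (Fin n)} {m : Fin n →₀ ℕ} :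
    sqfreeExponent A ≤ m ↔ A ⊆ m.support := by
  refine ⟨fun h => ?_, fun h i => ?_⟩
  · rw [← support_sqfreeExponent A]
    exact Finsupp.support_mono h
  · rw [sqfreeExponent_apply]
    split_ifs with hi
    · exact Nat.one_le_iff_ne_zero.2 (Finsupp.mem_support_iff.1 (h hi))
    · exact Nat.zero_le _

lemma sqfreeExponent_insert {A : Finset (Fin n)} {v : Fin n} (hv : v ∉ A) :
    sqfreeExponent (insert v A) = sqfreeExponent A + Finsupp.single v 1 := by
  rw [sqfreeExponent, Finset.sum_insert hv, add_comm]
  rfl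

/-- The exponents of the monomials in the ideal generated by the squarefree monomials with
supports in `𝒜`. -/
def exponentSet (𝒜 : Set (Finset (Fin n))) : Set (Fin n →₀ ℕ) :=
  {m | ∃ A ∈ 𝒜, A ⊆ m.support}

lemma restrictScalars_span_sqfreeMonomial (𝒜 : Set (Finset (Fin n))) :
    (Ideal.span (sqfreeMonomial K '' 𝒜)).restrictScalars K =
      restrictSupport K (exponentSet 𝒜) := by
  ext p
  have : sqfreeMonomial K '' 𝒜 = (fun s => monomial s (1 : K)) '' (sqfreeExponent '' 𝒜) := by
    rw [Set.image_image]
    exact Set.image_congr fun A _ => sqfreeMonomial_eq A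
  rw [Submodule.restrictScalars_mem, this, mem_ideal_span_monomial_image, mem_restrictSupport_iff]
  simp [Set.subset_def, exponentSet, sqfreeExponent_le_iff]

lemma monomial_mem_span_sqfreeMonomial {𝒜 : Set (Finset (Fin n))} {m : Fin n →₀ ℕ} {c : K}
    (hc : c ≠ 0) :
    monomial m c ∈ Ideal.span (sqfreeMonomial K '' 𝒜) ↔ m ∈ exponentSet 𝒜 := by
  rw [← Submodule.restrictScalars_mem K, restrictScalars_span_sqfreeMonomial,
    monomial_mem_restrictSupport]
  simp [hc]

lemma minGens_span_sqfreeMonomial {𝒜 : Set (Finset (Fin n))} (h𝒜 : IsAntichain (· ⊆ ·) 𝒜) :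
    minGens (Ideal.span (sqfreeMonomial K '' 𝒜)) = sqfreeExponent '' 𝒜 := by
  ext a
  simp only [minGens, Set.mem_ofPred_eq, monomial_mem_span_sqfreeMonomial (one_ne_zero (α := K))]
  constructor
  · rintro ⟨⟨A, hA, hAa⟩, hmin⟩
    have hle := sqfreeExponent_le_iff.2 hAa
    exact ⟨A, hA, le_antisymm hle (hmin ⟨A, hA, by simp⟩ hle)⟩
  · rintro ⟨A, hA, rfl⟩
    refine ⟨⟨A, hA, by simp⟩, ?_⟩
    rintro b ⟨B, hB, hBb⟩ hb
    have hbA : b.support ⊆ A := by simpa using Finsupp.support_mono hb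
    have hBA : B = A := h𝒜.eq hB hA (hBb.trans hbA)
    exact sqfreeExponent_le_iff.2 (hBA ▸ hBb)

/-! ### Stanley spaces as spans of monomials -/

/-- The exponents of the monomials in `x^a K[Z]`. -/
def stanleyCone (a : Fin n →₀ ℕ) (Z : Finset (Fin n)) : Set (Fin n →₀ ℕ) :=
  {m | ∃ b : Fin n →₀ ℕ, b.support ⊆ Z ∧ m = a + b}

/-- The monomials in `x_A K[A]` are those with support exactly `A`. -/
lemma mem_stanleyCone_sqfreeExponent {A : Finset (Fin n)} {m : Fin n →₀ ℕ} :
    m ∈ stanleyCone (sqfreeExponent A) A ↔ m.support = A := by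
  constructor
  · rintro ⟨b, hb, rfl⟩
    refine Finset.Subset.antisymm ?_ (sqfreeExponent_le_iff.1 le_self_add)
    exact Finsupp.support_add.trans (Finset.union_subset (support_sqfreeExponent A).le hb)
  · rintro rfl
    refine ⟨m - sqfreeExponent m.support, Finsupp.support_tsub, ?_⟩
    rw [add_tsub_cancel_of_le (sqfreeExponent_le_iff.2 subset_rfl)]

lemma stanleySpace_monomial (a : Fin n →₀ ℕ) {c : K} (hc : c ≠ 0) (Z : Finset (Fin n)) :
    stanleySpace (monomial a c) Z = restrictSupport K (stanleyCone a Z) := by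
  have hmem : ∀ p : MvPolynomial (Fin n) K,
      p ∈ Algebra.adjoin K (X '' (Z : Set (Fin n))) ↔ ∀ m ∈ p.support, m.support ⊆ Z := by
    intro p
    rw [← supported_eq_adjoin_X, mem_supported, Finset.coe_subset]
    simp only [Finset.subset_iff, mem_vars_iff_mem_support]
    exact ⟨fun h m hm i hi => h ⟨m, hm, hi⟩, fun h i ⟨m, hm, hi⟩ => h m hm hi⟩
  apply le_antisymm
  · rintro _ ⟨q, hq, rfl⟩
    have hq' := (hmem q).1 hq
    rw [mem_restrictSupport_iff]
    intro m hm
    rw [Finset.mem_coe, mem_support_iff, LinearMap.mulLeft_apply, coeff_monomial_mul'] at hm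
    split_ifs at hm with hle
    · exact ⟨m - a, hq' _ (mem_support_iff.2 (right_ne_zero_of_mul hm)),
        (add_tsub_cancel_of_le hle).symm⟩
    · exact absurd rfl hm
  · rw [restrictSupport_eq_span, Submodule.span_le]
    rintro _ ⟨_, ⟨b, hb, rfl⟩, rfl⟩
    refine ⟨monomial b c⁻¹, (hmem _).2 fun m hm => ?_, ?_⟩
    · rw [Finset.mem_singleton.1 (support_monomial_subset hm)]
      exact hb
    · rw [LinearMap.mulLeft_apply, monomial_mul, mul_inv_cancel₀ hc]

lemma iSup_restrictSupport {ι : Sort*} (s : ι → Set (Fin n →₀ ℕ)) :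
    ⨆ i, restrictSupport K (s i) = restrictSupport K (⋃ i, s i) := by
  simp_rw [restrictSupport_eq_span, Set.image_iUnion, Submodule.span_iUnion]

lemma disjoint_restrictSupport_iff {s t : Set (Fin n →₀ ℕ)} :
    Disjoint (restrictSupport K s) (restrictSupport K t) ↔ Disjoint s t := by
  rw [Submodule.disjoint_def, Set.disjoint_left]
  constructor
  · intro h m hs ht
    have := h (monomial m 1) ((monomial_mem_restrictSupport K).2 (Or.inl hs))
      ((monomial_mem_restrictSupport K).2 (Or.inl ht))
    exact one_ne_zero (monomial_eq_zero.1 this)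
  · intro h p hs ht
    rw [← support_eq_empty, Finset.eq_empty_iff_forall_notMem]
    exact fun m hm => h (hs hm) (ht hm)

lemma iSupIndep_restrictSupport_iff {ι : Type*} {s : ι → Set (Fin n →₀ ℕ)} :
    iSupIndep (fun i => restrictSupport K (s i)) ↔ Pairwise fun i j => Disjoint (s i) (s j) := by
  constructor
  · exact fun h i j hij => disjoint_restrictSupport_iff.1 (h.pairwiseDisjoint hij)
  · intro h i
    simp_rw [iSup_restrictSupport, disjoint_restrictSupport_iff, Set.disjoint_iUnion_right]
    exact fun j hj => h hj.symm

/-! ### Stanley depth of squarefree monomial ideals -/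

/-- Sorting the monomials of a squarefree ideal by their supports gives a Stanley decomposition
into the spaces `x_A K[A]`, so the Stanley depth is at least the least degree of a generator. -/
theorem exists_stanleyDecomposition_le_depth {𝒜 : Set (Finset (Fin n))} {d : ℕ}
    (hne : 𝒜.Nonempty) (hd : ∀ A ∈ 𝒜, d ≤ A.card) :
    ∃ P : StanleyDecomposition (Ideal.span (sqfreeMonomial K '' 𝒜)), d ≤ P.depth := by
  classical
  let ι := {A : Finset (Fin n) // ∃ B ∈ 𝒜, B ⊆ A}
  let φ : Fin (Fintype.card ι) ≃ ι := (Fintype.equivFin ι).symm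
  have hspace : (fun i => stanleySpace (sqfreeMonomial K (φ i).1) (φ i).1) = fun i =>
      restrictSupport K (stanleyCone (sqfreeExponent (φ i).1) (φ i).1) := by
    funext i
    rw [sqfreeMonomial_eq, stanleySpace_monomial _ one_ne_zero]
  let P : StanleyDecomposition (Ideal.span (sqfreeMonomial K '' 𝒜)) :=
    { m := Fintype.card ι
      u := fun i => sqfreeMonomial K (φ i).1
      Z := fun i => (φ i).1
      mem := fun i => by
        rw [sqfreeMonomial_eq, monomial_mem_span_sqfreeMonomial one_ne_zero]
        simpa [exponentSet] using (φ i).2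
      homogeneous := fun i => ⟨_, _, sqfreeMonomial_eq _⟩
      ne_zero := fun i => by
        rw [sqfreeMonomial_eq, Ne, monomial_eq_zero]
        exact one_ne_zero
      independent := by
        rw [hspace, iSupIndep_restrictSupport_iff]
        refine fun i j hij => Set.disjoint_left.2 fun m hi hj => hij (φ.injective ?_)
        rw [mem_stanleyCone_sqfreeExponent] at hi hj
        exact Subtype.ext (hi.symm.trans hj)
      iSup_eq := by
        rw [hspace, iSup_restrictSupport, restrictScalars_span_sqfreeMonomial]
        congr 1
        ext m
        simp only [Set.mem_iUnion, mem_stanleyCone_sqfreeExponent]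
        exact ⟨fun ⟨i, hi⟩ => by rw [exponentSet, Set.mem_ofPred_eq, hi]; exact (φ i).2,
          fun hm => ⟨φ.symm ⟨m.support, hm⟩, by simp⟩⟩ }
  obtain ⟨A, hA⟩ := hne
  have : Nonempty (Fin P.m) := ⟨φ.symm ⟨A, A, hA, subset_rfl⟩⟩
  refine ⟨P, le_ciInf fun i => ?_⟩
  obtain ⟨B, hB, hBA⟩ := (φ i).2
  exact (hd B hB).trans (Finset.card_le_card hBA)

/-- For an ideal generated by squarefree monomials `x_A` of degree `d`, each `x_A` is the generator
of its own summand `x_A K[Z]` of a Stanley decomposition. If always `|Z| > d`, then the summand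
contains some `x_A x_v` with `v ∉ A`, and the monomials found in this way are distinct, since they
lie in distinct summands. -/
theorem exists_injOn_insert_of_stanleyDecomposition {𝒜 : Set (Finset (Fin n))} {d : ℕ}
    (h𝒜 : 𝒜.Sized d) (P : StanleyDecomposition (Ideal.span (sqfreeMonomial K '' 𝒜)))
    (hP : ∀ i, d < (P.Z i).card) :
    ∃ f : Finset (Fin n) → Finset (Fin n),
      (∀ A ∈ 𝒜, ∃ v ∉ A, f A = insert v A) ∧ Set.InjOn f 𝒜 := by
  choose a c hu using P.homogeneous
  have hc : ∀ i, c i ≠ 0 := fun i h => P.ne_zero i (by rw [hu, h, monomial_zero])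
  have hspace : (fun i => stanleySpace (P.u i) (P.Z i)) = fun i =>
      restrictSupport K (stanleyCone (a i) (P.Z i)) := by
    funext i
    rw [hu, stanleySpace_monomial _ (hc i)]
  have hdisj := P.independent
  rw [hspace, iSupIndep_restrictSupport_iff] at hdisj
  have hsup := P.iSup_eq
  rw [hspace, iSup_restrictSupport, restrictScalars_span_sqfreeMonomial] at hsup
  have key : ∀ A ∈ 𝒜, ∃ i, ∃ v ∉ A, v ∈ P.Z i ∧ a i = sqfreeExponent A := by
    intro A hA
    have hmem : monomial (sqfreeExponent A) (1 : K) ∈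
        restrictSupport K (⋃ i, stanleyCone (a i) (P.Z i)) := by
      rw [hsup]
      exact (monomial_mem_restrictSupport K).2 (Or.inl ⟨A, hA, by simp⟩)
    obtain ⟨i, b, -, hAb⟩ := Set.mem_iUnion.1
      (((monomial_mem_restrictSupport K).1 hmem).resolve_right one_ne_zero)
    obtain ⟨B, hB, hBa⟩ : a i ∈ exponentSet 𝒜 := by
      rw [← monomial_mem_span_sqfreeMonomial (hc i), ← hu]
      exact P.mem i
    have hle : a i ≤ sqfreeExponent A := hAb ▸ le_self_add
    have hBA : B ⊆ A := by
      simpa using hBa.trans (Finsupp.support_mono hle)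
    obtain rfl := Finset.eq_of_subset_of_card_le hBA (by rw [h𝒜 hA, h𝒜 hB])
    obtain ⟨v, hv, hvB⟩ := Finset.exists_mem_notMem_of_card_lt_card
      (show B.card < (P.Z i).card by rw [h𝒜 hB]; exact hP i)
    exact ⟨i, v, hvB, hv, le_antisymm hle (sqfreeExponent_le_iff.2 hBa)⟩
  have hinsert : ∀ A, ∃ F, A ∈ 𝒜 → (∃ v ∉ A, F = insert v A) ∧
      ∃ i, a i = sqfreeExponent A ∧ sqfreeExponent F ∈ stanleyCone (a i) (P.Z i) := by
    intro A
    by_cases hA : A ∈ 𝒜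
    · obtain ⟨i, v, hvA, hv, hai⟩ := key A hA
      refine ⟨insert v A, fun _ => ⟨⟨v, hvA, rfl⟩, i, hai, Finsupp.single v 1, ?_, ?_⟩⟩
      · exact Finsupp.support_single_subset.trans (Finset.singleton_subset_iff.2 hv)
      · rw [sqfreeExponent_insert hvA, hai]
    · exact ⟨∅, fun h => absurd h hA⟩
  choose f hf using hinsert
  refine ⟨f, fun A hA => (hf A hA).1, fun A hA A' hA' heq => sqfreeExponent_injective ?_⟩
  obtain ⟨-, i, hi, hmem⟩ := hf A hA
  obtain ⟨-, j, hj, hmem'⟩ := hf A' hA'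
  rw [← heq] at hmem'
  have hij : i = j := by
    by_contra hij
    exact Set.disjoint_left.1 (hdisj hij) hmem hmem'
  rw [← hi, ← hj, hij]

end Monomial

/-! ### Complement ideals -/

section ComplementIdeal

variable {K : Type*} [Field K] {n d k : ℕ} {B : Finset (Finset (Fin n))}

lemma complementIdeal_generate (hB : (B : Set (Finset (Fin n))).Sized k) :
    complementIdeal K (Complex.generate (B : Set (Finset (Fin n)))) =
      Ideal.span (sqfreeMonomial K '' (compl '' (B : Set (Finset (Fin n))))) := by
  rw [complementIdeal, Complex.facets_generate hB, Set.image_image]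
  congr 1
  ext m
  exact exists_congr fun F => and_congr_right fun _ => eq_comm

lemma sized_compl_image (hB : (B : Set (Finset (Fin n))).Sized k) (hdk : d + k = n) :
    (compl '' (B : Set (Finset (Fin n)))).Sized d := by
  rintro _ ⟨F, hF, rfl⟩
  rw [Finset.card_compl, Fintype.card_fin, hB hF]
  omega

lemma complementComplex_complementIdeal_generate (hB : (B : Set (Finset (Fin n))).Sized k)
    (hdk : d + k = n) :
    complementComplex (complementIdeal K (Complex.generate (B : Set (Finset (Fin n))))) =
      Complex.generate (B : Set (Finset (Fin n))) := by
  rw [complementComplex, complementIdeal_generate hB,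
    minGens_span_sqfreeMonomial (sized_compl_image hB hdk).isAntichain]
  congr 1
  ext F
  simp

lemma mu_complementIdeal_generate (hB : (B : Set (Finset (Fin n))).Sized k) (hdk : d + k = n) :
    mu d (complementIdeal K (Complex.generate (B : Set (Finset (Fin n))))) = B.card := by
  have hs := sized_compl_image hB hdk
  rw [mu, complementIdeal_generate hB, minGens_span_sqfreeMonomial hs.isAntichain,
    Set.sep_eq_self_iff_mem_true.2, Set.ncard_image_of_injective _ sqfreeExponent_injective,
    Set.ncard_image_of_injective _ compl_injective, Set.ncard_coe_finset]
  rintro _ ⟨A, hA, rfl⟩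
  rw [degree_sqfreeExponent, hs hA]

/-- A Stanley decomposition of depth greater than `d` would make the complex uniformly
collapsible, since adding a vertex to a set is dropping it from the complement. -/
theorem isStanleyDepth_complementIdeal_generate (hB : (B : Set (Finset (Fin n))).Sized k)
    (hdk : d + k = n) (hne : B.Nonempty)
    (hcol : ¬ (Complex.generate (B : Set (Finset (Fin n)))).UniformlyCollapsible) :
    IsStanleyDepth (complementIdeal K (Complex.generate (B : Set (Finset (Fin n))))) d := by
  have hs := sized_compl_image hB hdk
  rw [complementIdeal_generate hB]
  have hub : ∀ P : StanleyDecomposition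
      (Ideal.span (sqfreeMonomial K '' (compl '' (B : Set (Finset (Fin n)))))), P.depth ≤ d := by
    intro P
    by_contra! hlt
    obtain ⟨f, hf, hinj⟩ := exists_injOn_insert_of_stanleyDecomposition hs P
      fun i => hlt.trans_le (ciInf_le (OrderBot.bddBelow _) i)
    refine hcol ⟨fun F => (f Fᶜ)ᶜ, ?_, ?_⟩ <;> rw [Complex.facets_generate hB]
    · intro F hF
      obtain ⟨v, hv, h⟩ := hf Fᶜ ⟨F, hF, rfl⟩
      refine ⟨v, by simpa using hv, ?_⟩
      change (f Fᶜ)ᶜ = F.erase v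
      rw [h, Finset.compl_insert, compl_compl]
    · intro F hF G hG h
      exact compl_injective (hinj ⟨F, hF, rfl⟩ ⟨G, hG, rfl⟩ (compl_injective h))
  obtain ⟨P, hP⟩ := exists_stanleyDecomposition_le_depth (K := K)
    ((Finset.coe_nonempty.2 hne).image compl) fun A hA => (hs hA).ge
  refine ⟨⟨P, le_antisymm (hub P) hP⟩, ?_⟩
  rintro _ ⟨Q, rfl⟩
  exact hub Q

end ComplementIdeal

end StanleyDepth

theorem mainTheorem3 (K : Type*) [Field K] (n d δ : ℕ) (hδ : d + δ = n) (hn : 2 * δ ≤ n) :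
    -- the collection of facets is compressed and has `ξ_δ + 1` members
    (StanleyDepth.IsCompressed δ (StanleyDepth.compressed n δ (StanleyDepth.xi δ + 1)) ∧
      (StanleyDepth.compressed n δ (StanleyDepth.xi δ + 1)).card = StanleyDepth.xi δ + 1 ∧
      (StanleyDepth.compressedComplex n δ (StanleyDepth.xi δ + 1)).facets =
        (StanleyDepth.compressed n δ (StanleyDepth.xi δ + 1) : Set (Finset (Fin n)))) ∧
    -- the complex is pure, has `ξ_δ + 1` facets and `ξ_δ` ridges, and is not uniformly collapsible
    ((StanleyDepth.compressedComplex n δ (StanleyDepth.xi δ + 1)).IsPure ((δ : ℤ) - 1) ∧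
      (StanleyDepth.compressedComplex n δ (StanleyDepth.xi δ + 1)).fNumber ((δ : ℤ) - 1) =
        StanleyDepth.xi δ + 1 ∧
      (StanleyDepth.compressedComplex n δ (StanleyDepth.xi δ + 1)).fNumber ((δ : ℤ) - 2) =
        StanleyDepth.xi δ ∧
      ¬ (StanleyDepth.compressedComplex n δ (StanleyDepth.xi δ + 1)).UniformlyCollapsible) ∧
    -- the complement ideal: its class, its complement complex, `μ_d` and the Stanley depth
    (StanleyDepth.GeneratedBySqfreeOfDegreeGE
        (StanleyDepth.compressedIdeal K n d (StanleyDepth.xi δ + 1)) d ∧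
      StanleyDepth.complementComplex (StanleyDepth.compressedIdeal K n d (StanleyDepth.xi δ + 1)) =
        StanleyDepth.compressedComplex n δ (StanleyDepth.xi δ + 1) ∧
      StanleyDepth.mu d (StanleyDepth.compressedIdeal K n d (StanleyDepth.xi δ + 1)) =
        StanleyDepth.xi δ + 1 ∧
      StanleyDepth.IsStanleyDepth (StanleyDepth.compressedIdeal K n d (StanleyDepth.xi δ + 1)) d) ∧
    -- sharpness: `μ_d(I)` exceeds by one the bound `min (binom n (d+1)) ξ_δ`
    (min (n.choose (d + 1)) (StanleyDepth.xi δ) = StanleyDepth.xi δ ∧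
      StanleyDepth.mu d (StanleyDepth.compressedIdeal K n d (StanleyDepth.xi δ + 1)) =
        min (n.choose (d + 1)) (StanleyDepth.xi δ) + 1) := by
  obtain ⟨B, hB, hcard, hshadow, -⟩ := StanleyDepth.exists_isInitSeg_card_shadow n δ hn
  have hC : StanleyDepth.compressed n δ (StanleyDepth.xi δ + 1) = B := by
    rw [← hcard]
    exact StanleyDepth.compressed_card_eq_of_isInitSeg hB
  have hI : StanleyDepth.compressedIdeal K n d (StanleyDepth.xi δ + 1) =
      StanleyDepth.complementIdeal K
        (StanleyDepth.Complex.generate (B : Set (Finset (Fin n)))) := by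
    rw [StanleyDepth.compressedIdeal, StanleyDepth.compressedComplex,
      show n - d = δ by omega, hC]
  have hfacets := StanleyDepth.Complex.facets_generate hB.1
  have hcol := StanleyDepth.Complex.not_uniformlyCollapsible_generate hB.1
    (by rw [hcard, hshadow]; exact Nat.lt_succ_self _)
  have hmu := StanleyDepth.mu_complementIdeal_generate (K := K) hB.1 hδ
  -- The ridges form a family of `(δ - 1)`-subsets of `[n]`, and `n - (δ - 1) = d + 1`.
  have hmin : min (n.choose (d + 1)) (StanleyDepth.xi δ) = StanleyDepth.xi δ := by
    refine min_eq_right ?_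
    rcases Nat.eq_zero_or_pos δ with rfl | hpos
    · simp [StanleyDepth.xi]
    · have h := hB.1.shadow.card_le
      rw [hshadow, Fintype.card_fin, ← Nat.choose_symm (by omega)] at h
      rwa [show n - (δ - 1) = d + 1 by omega] at h
  rw [hmin, StanleyDepth.compressedComplex, hI, hC, hmu]
  refine ⟨⟨StanleyDepth.isCompressed_of_isInitSeg hB, hcard, hfacets⟩,
    ⟨fun F hF => ?_, ?_, ?_, hcol⟩, ⟨⟨_, ?_, StanleyDepth.complementIdeal_generate hB.1⟩,
      StanleyDepth.complementComplex_complementIdeal_generate hB.1 hδ, hcard,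
      StanleyDepth.isStanleyDepth_complementIdeal_generate hB.1 hδ
        (Finset.card_pos.1 (by omega)) hcol⟩, rfl, hcard⟩
  · rw [hfacets] at hF
    rw [hB.1 hF]
    ring
  · rw [StanleyDepth.Complex.fNumber_generate_top hB.1, hcard]
  · rw [StanleyDepth.Complex.fNumber_generate_ridges hB.1, hshadow]
  · exact fun A hA => (StanleyDepth.sized_compl_image hB.1 hδ hA).ge
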